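/- Let $C=\{f=0\}$ be a germ of a reduced plane curve at the origin of $\mathbb C^2$ ($f\in\mathcal O_{\mathbb C^2,0}$), with irreducible components $C_1,\dots,C_r$, and let $\mathcal O_C=\mathcal O_{\mathbb C^2,0}/(f)$ be the ring of germs of analytic functions on $C$. Let $\varphi_i:(\mathbb C,0)\to(\mathbb C^2,0)$ be a parametrization of $C_i$, that is, a germ of an analytic map with image $C_i$ which is an isomorphism onto $C_i$ outside of the origin ($i=1,\dots,r$). For $g\in\mathcal O_C$ let $v_i(g)\in\mathbb Z_{\ge 0}\cup\{\infty\}$ be the order at $0$ of $g\circ\varphi_i$. For $v=(v_1,\dots,v_r)\in\mathbb Z^r$ let $$J(v)=\{g\in\mathcal O_C:\ v_i(g)\ge v_i,\ i=1,\dots,r\},$$ let $j_v:J(v)\to\mathbb C^r$ be the linear map that sends $g$ to $(a_1,\dots,a_r)$, where $a_i$ is the (possibly zero) coefficient of $t^{v_i}$ in the power series expansion of $g\circ\varphi_i(t)$ (so $a_i=0$ if $v_i<0$), and let $c(v)=\dim_{\mathbb C} j_v(J(v))$. In the $\mathbb Z[t_1,\dots,t_r]$-module of formal Laurent series $\sum_{v\in\mathbb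 Z^r}k(v)\,t_1^{v_1}\cdots t_r^{v_r}$, $k(v)\in\mathbb Z$ (infinite in all directions), put $$L_C=\sum_{v\in\mathbb Z^r}c(v)\,t_1^{v_1}\cdots t_r^{v_r},\qquad P'_C=(t_1-1)\cdots(t_r-1)\cdot L_C .$$ **Proposition.** If $r>1$, then $P'_C$ is a polynomial in $\mathbb Z[t_1,\dots,t_r]$ and is divisible in $\mathbb Z[t_1,\dots,t_r]$ by $t_1\cdots t_r-1$; that is, the power series $P_C=P'_C/(t_1\cdots t_r-1)\in\mathbb Z[[t_1,\dots,t_r]]$ is a polynomial, $P_C\in\mathbb Z[t_1,\dots,t_r]$. -/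

import Mathlib

open Filter Topology

noncomputable section

namespace PlaneCurveSing

/-! ### Rings of germs of holomorphic functions -/

/-- The `ℂ`-algebra structure on germs of complex valued functions (pointwise operations). -/
instance germAlgebra {α : Type*} (l : Filter α) : Algebra ℂ (Germ l ℂ) :=
  Algebra.ofModule
    (fun c f g => Quotient.inductionOn₂' f g fun F G =>
      congrArg (Germ.ofFun (l := l)) (smul_mul_assoc c F G))
    (fun c f g => Quotient.inductionOn₂' f g fun F G =>
      congrArg (Germ.ofFun (l := l)) (mul_smul_comm c F G))

/-- The ring `𝒪_{E,0}` of germs at the origin of holomorphic functions on `E`,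
as a subalgebra of the algebra of all germs at `0` of functions `E → ℂ`. -/
def HolGerm (E : Type*) [NormedAddCommGroup E] [NormedSpace ℂ E] :
    Subalgebra ℂ (Germ (𝓝 (0 : E)) ℂ) where
  carrier := {g | ∃ G : E → ℂ, AnalyticAt ℂ G 0 ∧ (G : Germ (𝓝 (0 : E)) ℂ) = g}
  mul_mem' := by
    rintro _ _ ⟨F, hF, rfl⟩ ⟨G, hG, rfl⟩
    exact ⟨F * G, hF.mul hG, rfl⟩
  add_mem' := by
    rintro _ _ ⟨F, hF, rfl⟩ ⟨G, hG, rfl⟩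
    exact ⟨F + G, hF.add hG, rfl⟩
  algebraMap_mem' := by
    intro c
    refine ⟨fun _ => c, analyticAt_const, ?_⟩
    rw [Algebra.algebraMap_eq_smul_one]
    exact congrArg (Germ.ofFun (l := 𝓝 (0 : E))) (funext fun x => by simp)

/-- The germ at `0` of a function that is holomorphic near `0`. -/
def HolGerm.mk {E : Type*} [NormedAddCommGroup E] [NormedSpace ℂ E] (G : E → ℂ)
    (hG : AnalyticAt ℂ G 0) : HolGerm E :=
  ⟨(G : Germ (𝓝 (0 : E)) ℂ), G, hG, rfl⟩

/-! ### Germs in one variable: order and coefficients -/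

/-- The power of the leading term in the power series expansion of a germ in one variable;
`⊤` for the zero germ. -/
def HolGerm.order (h : HolGerm ℂ) : ℕ∞ :=
  Germ.liftOn h.1 (fun H => analyticOrderAt H 0) fun _ _ hFG => analyticOrderAt_congr hFG

/-- The coefficient of `t ^ n` in the power series expansion of a germ in one variable. -/
def HolGerm.coeff (n : ℕ) : HolGerm ℂ →ₗ[ℂ] ℂ where
  toFun h := Germ.liftOn h.1 (fun H => iteratedDeriv n H 0 / (n.factorial : ℂ))
    fun _ _ hFG => by simp only [hFG.iteratedDeriv_eq n]
  map_add' := by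
    rintro ⟨_, F, hF, rfl⟩ ⟨_, G, hG, rfl⟩
    change iteratedDeriv n (F + G) 0 / (n.factorial : ℂ) = iteratedDeriv n F 0 / (n.factorial : ℂ)
      + iteratedDeriv n G 0 / (n.factorial : ℂ)
    rw [iteratedDeriv_add hF.contDiffAt hG.contDiffAt, add_div]
  map_smul' := by
    rintro c ⟨_, F, hF, rfl⟩
    change iteratedDeriv n (c • F) 0 / (n.factorial : ℂ)
      = c • (iteratedDeriv n F 0 / (n.factorial : ℂ))
    rw [iteratedDeriv_const_smul hF.contDiffAt c, smul_eq_mul, smul_eq_mul, mul_div_assoc]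

/-- The coefficient of `t ^ n` for an integer exponent `n` (zero if `n < 0`). -/
def HolGerm.zcoeff (n : ℤ) : HolGerm ℂ →ₗ[ℂ] ℂ :=
  if 0 ≤ n then HolGerm.coeff n.toNat else 0

/-- The pull-back `g ↦ g ∘ φ` along the germ of an analytic map `φ : (ℂ, 0) → (ℂ², 0)`. -/
def pullback (φ : ℂ → ℂ × ℂ) (hφ : AnalyticAt ℂ φ 0) (h0 : φ 0 = 0) :
    HolGerm (ℂ × ℂ) →ₐ[ℂ] HolGerm ℂ :=
  have ht : Tendsto φ (𝓝 0) (𝓝 0) := by simpa [h0] using hφ.continuousAt.tendsto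
  AlgHom.ofLinearMap
    { toFun := fun g => ⟨Germ.compTendsto g.1 φ ht, by
        obtain ⟨_, G, hG, rfl⟩ := g
        exact ⟨G ∘ φ, AnalyticAt.comp (by rwa [h0]) hφ, rfl⟩⟩
      map_add' := by
        rintro ⟨_, F, hF, rfl⟩ ⟨_, G, hG, rfl⟩
        rfl
      map_smul' := by
        rintro c ⟨_, F, hF, rfl⟩
        rfl }
    rfl
    (by
      rintro ⟨_, F, hF, rfl⟩ ⟨_, G, hG, rfl⟩
      rfl)

/-! ### Germs of analytic subsets of `ℂ²` at the origin

A germ of a set is represented by a set; equality of germs of sets is `=ᶠ[𝓝 0]`. -/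

/-- `Z` represents the germ at `0` of an analytic set: near `0` it is the common zero set of
finitely many holomorphic functions. -/
def IsAnalyticGerm (Z : Set (ℂ × ℂ)) : Prop :=
  ∃ (k : ℕ) (h : Fin k → ℂ × ℂ → ℂ), (∀ j, AnalyticAt ℂ (h j) 0) ∧
    Z =ᶠ[𝓝 0] {x | ∀ j, h j x = 0}

/-- `Z` represents an irreducible germ of an analytic set at `0`: it is non-empty and not the union
of two analytic germs different from it. -/
def IsIrreducibleGerm (Z : Set (ℂ × ℂ)) : Prop :=
  IsAnalyticGerm Z ∧ (0 : ℂ × ℂ) ∈ Z ∧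
    ∀ A B : Set (ℂ × ℂ), IsAnalyticGerm A → IsAnalyticGerm B → Z =ᶠ[𝓝 0] (A ∪ B : Set (ℂ × ℂ)) →
      Z =ᶠ[𝓝 0] A ∨ Z =ᶠ[𝓝 0] B

/-! ### Plane curve singularities -/

/-- A germ `C = {f = 0}` of a reduced plane curve at the origin of `ℂ²`, together with a numbering
of its `r` irreducible components. -/
structure PlaneCurve (r : ℕ) where
  /-- a representative of the equation `f` of the curve -/
  f : ℂ × ℂ → ℂ
  analytic : AnalyticAt ℂ f 0
  map_zero : f 0 = 0
  reduced : Squarefree (HolGerm.mk f analytic)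
  /-- (representatives of) the irreducible components `C_1, …, C_r` -/
  comp : Fin r → Set (ℂ × ℂ)
  irreducible : ∀ i, IsIrreducibleGerm (comp i)
  not_subset : ∀ i j, i ≠ j → ¬ ∀ᶠ x in 𝓝 (0 : ℂ × ℂ), x ∈ comp i → x ∈ comp j
  union_eq : {x | f x = 0} =ᶠ[𝓝 0] ⋃ i, comp i

/-- A parametrization (uniformization) `φ : (ℂ, 0) → (ℂ², 0)` of a germ `Z` of a curve: a germ
of an analytic map whose image is the germ `Z` and which is an isomorphism onto `Z` outside of the
origin. -/
structure Parametrization (Z : Set (ℂ × ℂ)) where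
  φ : ℂ → ℂ × ℂ
  analytic : AnalyticAt ℂ φ 0
  map_zero : φ 0 = 0
  /-- the germ `Z` is the image of `φ`: the neighbourhoods of `0` in `Z` are
  the images of the neighbourhoods of `0` in `ℂ` -/
  image_eq : Filter.map φ (𝓝 0) = 𝓝[Z] 0
  injective : ∃ U ∈ 𝓝 (0 : ℂ), Set.InjOn φ U
  immersive : ∀ᶠ t in 𝓝[≠] (0 : ℂ), deriv φ t ≠ 0

variable {r : ℕ}

/-- The ring `𝒪_C = 𝒪_{ℂ²,0} / (f)` of germs of analytic functions on `C`. -/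
abbrev PlaneCurve.Ring (C : PlaneCurve r) : Type :=
  HolGerm (ℂ × ℂ) ⧸ Ideal.span {HolGerm.mk C.f C.analytic}

/-- The equation of the curve vanishes identically along a parametrization of a component. -/
theorem PlaneCurve.pullback_eq_zero (C : PlaneCurve r) {i : Fin r}
    (p : Parametrization (C.comp i)) :
    pullback p.φ p.analytic p.map_zero (HolGerm.mk C.f C.analytic) = 0 := by
  apply Subtype.ext
  change ((C.f ∘ p.φ : ℂ → ℂ) : Germ (𝓝 (0 : ℂ)) ℂ) = ((fun _ => 0 : ℂ → ℂ) : Germ (𝓝 (0 : ℂ)) ℂ)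
  refine Germ.coe_eq.2 ?_
  have h1 : ∀ᶠ x in 𝓝[C.comp i] (0 : ℂ × ℂ), C.f x = 0 := by
    refine eventually_nhdsWithin_iff.2 ?_
    filter_upwards [eventuallyEq_set.1 C.union_eq] with x hx hxi
    exact hx.2 (Set.mem_iUnion.2 ⟨i, hxi⟩)
  rw [← p.image_eq] at h1
  exact Filter.eventually_map.1 h1

/-- The substitution `g ↦ g ∘ φ_i` on the ring `𝒪_C`. -/
def PlaneCurve.restrict (C : PlaneCurve r) {i : Fin r} (p : Parametrization (C.comp i)) :
    C.Ring →ₐ[ℂ] HolGerm ℂ :=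
  Ideal.Quotient.liftₐ _ (pullback p.φ p.analytic p.map_zero) (by
    intro a ha
    obtain ⟨b, rfl⟩ := Ideal.mem_span_singleton'.1 ha
    rw [map_mul, C.pullback_eq_zero p, mul_zero])

/-- The order `v_i(g) ∈ ℕ ∪ {∞}` of `g ∈ 𝒪_C` along the `i`-th component. -/
def PlaneCurve.v (C : PlaneCurve r) (φ : ∀ i, Parametrization (C.comp i)) (i : Fin r)
    (g : C.Ring) : ℕ∞ :=
  HolGerm.order (C.restrict (φ i) g)

/-- The ideal `J(v) = {g ∈ 𝒪_C : v_i(g) ≥ v_i, i = 1, …, r}` for `v ∈ ℤ^r`. As `v_i(g) ≥ 0`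
always holds, the inequality `v_i(g) ≥ v_i` in `ℤ ∪ {∞}` is `v_i(g) ≥ max(v_i, 0)`. -/
def PlaneCurve.J (C : PlaneCurve r) (φ : ∀ i, Parametrization (C.comp i)) (v : Fin r → ℤ) :
    Ideal C.Ring where
  carrier := {g | ∀ i, ((v i).toNat : ℕ∞) ≤ C.v φ i g}
  zero_mem' := by
    intro i
    have : C.v φ i 0 = ⊤ := by
      unfold PlaneCurve.v
      rw [_root_.map_zero]
      exact analyticOrderAt_eq_top.2 (Eventually.of_forall fun _ => rfl)
    rw [this]
    exact le_top
  add_mem' := by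
    intro a b ha hb i
    have h : min (C.v φ i a) (C.v φ i b) ≤ C.v φ i (a + b) := by
      unfold PlaneCurve.v
      rw [map_add]
      obtain ⟨_, F, hF, hF'⟩ := C.restrict (φ i) a
      obtain ⟨_, G, hG, hG'⟩ := C.restrict (φ i) b
      subst hF' hG'
      exact le_analyticOrderAt_add
    exact (le_min (ha i) (hb i)).trans h
  smul_mem' := by
    intro a b hb i
    have h : C.v φ i b ≤ C.v φ i (a * b) := by
      unfold PlaneCurve.v
      rw [map_mul]
      obtain ⟨_, F, hF, hF'⟩ := C.restrict (φ i) a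
      obtain ⟨_, G, hG, hG'⟩ := C.restrict (φ i) b
      subst hF' hG'
      change analyticOrderAt G 0 ≤ analyticOrderAt (F * G) 0
      rw [analyticOrderAt_mul hF hG]
      exact le_add_self
    exact (hb i).trans h

/-- The linear map `j_v : J(v) → ℂ^r`, `g ↦ (a_1, …, a_r)`, where `a_i` is the (possibly zero)
coefficient of `t ^ v_i` in the expansion of `g ∘ φ_i`. -/
def PlaneCurve.j (C : PlaneCurve r) (φ : ∀ i, Parametrization (C.comp i)) (v : Fin r → ℤ) :
    (C.J φ v).restrictScalars ℂ →ₗ[ℂ] (Fin r → ℂ) :=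
  LinearMap.pi fun i =>
    HolGerm.zcoeff (v i) ∘ₗ (C.restrict (φ i)).toLinearMap ∘ₗ
      ((C.J φ v).restrictScalars ℂ).subtype

/-- `c(v) = dim C(v)`, where `C(v) ⊆ ℂ^r` is the image of `j_v`. -/
def PlaneCurve.c (C : PlaneCurve r) (φ : ∀ i, Parametrization (C.comp i)) (v : Fin r → ℤ) : ℕ :=
  Module.finrank ℂ (LinearMap.range (C.j φ v))

/-! ### Formal Laurent series, infinite in all directions -/

/-- The group `ℒ = ℤ[[t_1, …, t_r, t_1⁻¹, …, t_r⁻¹]]` of formal sums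
`∑_{v ∈ ℤ^r} k(v) t^v`; such a sum is given by its coefficients. -/
abbrev Laurent (r : ℕ) : Type := (Fin r → ℤ) → ℤ

/-- The multiplication of an element of `ℒ` by a polynomial:
`(∑_m a_m t^m) · (∑_v k(v) t^v) = ∑_v (∑_m a_m k(v - m)) t^v`. -/
def polyMul (p : MvPolynomial (Fin r) ℤ) (L : Laurent r) : Laurent r :=
  fun v => ∑ m ∈ p.support, p.coeff m * L fun i => v i - (m i : ℤ)

/-- The natural embedding of `ℤ[t_1, …, t_r]` in `ℒ`. -/
def ofPoly (p : MvPolynomial (Fin r) ℤ) : Laurent r :=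
  fun v => if ∀ i, 0 ≤ v i then p.coeff (Finsupp.equivFunOnFinite.symm fun i => (v i).toNat) else 0

/-- The power series formed by the terms of an element of `ℒ` with non-negative exponents. -/
def toPowerSeries (L : Laurent r) : MvPowerSeries (Fin r) ℤ :=
  fun m => L fun i => (m i : ℤ)

/-- `L_C = ∑_v c(v) t^v`. -/
def PlaneCurve.L (C : PlaneCurve r) (φ : ∀ i, Parametrization (C.comp i)) : Laurent r :=
  fun v => (C.c φ v : ℤ)

/-- `P'_C = (t_1 - 1) ⋯ (t_r - 1) · L_C`. -/
def PlaneCurve.P' (C : PlaneCurve r) (φ : ∀ i, Parametrization (C.comp i)) : Laurent r :=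
  polyMul (∏ i, (MvPolynomial.X i - 1)) (C.L φ)

/-- The polynomial `t_1 ⋯ t_r - 1`. -/
def tProdSubOne (r : ℕ) : MvPolynomial (Fin r) ℤ := (∏ i, MvPolynomial.X i) - 1

/-- `P_C = P'_C / (t_1 ⋯ t_r - 1) ∈ ℤ[[t_1, …, t_r]]`. Here `P'_C` is regarded as a power series
(it has no terms with negative exponents), and `t_1 ⋯ t_r - 1` is an invertible power series with
constant term `-1` (for `r ≥ 1`). -/
def PlaneCurve.P (C : PlaneCurve r) (φ : ∀ i, Parametrization (C.comp i)) :
    MvPowerSeries (Fin r) ℤ :=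
  toPowerSeries (C.P' φ) * MvPowerSeries.invOfUnit (tProdSubOne r : MvPowerSeries (Fin r) ℤ) (-1)

end PlaneCurveSing

end

/-! ### Power series: interpolation over the conjugates of a series -/

noncomputable section

open PowerSeries

/-! Put h(v) = dim 𝒪_C/J(v). Since J(v+1) is the kernel of j_v, c(v) = h(v+1) - h(v), so L_C =
(t_1⋯t_r - 1)·K with K(v) = -h(v+1). Hence P'_C is t_1⋯t_r - 1 times ∏(t_i - 1)·K, and it remains to
see that the latter is a polynomial. The coefficient of (t_i - 1)·K at v is the jump of h in
direction e_i; it is 0 for v_i < 0 and, as shown below, 1 for large v_i. As r > 1, a further factor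
t_k - 1 with k ≠ i annihilates both constant ranges, so the support lies in a box
(`exists_ofPoly_eq_polyMul_prod`).

The jump is 1 as soon as some function has order exactly v_i on C_i and vanishes on the other
branches (`PlaneCurve.exists_v_eq`). Such a function is a product of equations that vanish on the
other branches but not on C_i, times a function of prescribed order on C_i. All large orders occur
on a branch: in a coordinate s where one coordinate function is s^n, injectivity makes the
conjugates y(ζs) of the other one distinct, and Lagrange interpolation puts every multiple of
∏_{ζ≠1} (y(s) - y(ζs)) into ℂ⟦s^n⟧[y] (`PowerSeries.exists_mem_order_eq`). -/

instance rootsOfUnity.fintypeComplex (n : ℕ) [NeZero n] : Fintype (rootsOfUnity n ℂ) :=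
  Fintype.ofFinite _

/-- The Lagrange interpolation polynomial taking the value
`rescale ζ h * ∏ ζ' ≠ ζ, (rescale ζ y - rescale ζ' y)` at `rescale ζ y` for each `n`-th root of
unity `ζ`. -/
def PowerSeries.rootInterp (n : ℕ) [NeZero n] (y h : ℂ⟦X⟧) : Polynomial ℂ⟦X⟧ :=
  ∑ ζ : rootsOfUnity n ℂ, Polynomial.C (rescale ((ζ : ℂˣ) : ℂ) h) *
    ∏ ζ' : rootsOfUnity n ℂ, if ζ' = ζ then 1 else
      (Polynomial.X - Polynomial.C (rescale ((ζ' : ℂˣ) : ℂ) y))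

/-- Rescaling by ω permutes the conjugates, so it only reindexes the sum and the products by ζ ↦ ζω.
-/
theorem PowerSeries.map_rescale_rootInterp (n : ℕ) [NeZero n] (y h : ℂ⟦X⟧)
    (ω : rootsOfUnity n ℂ) :
    (rootInterp n y h).map (rescale ((ω : ℂˣ) : ℂ)) = rootInterp n y h := by
  unfold rootInterp
  rw [Polynomial.map_sum]
  refine Fintype.sum_equiv (Equiv.mulRight ω) _ _ fun ζ => ?_
  rw [Polynomial.map_mul, Polynomial.map_prod, Polynomial.map_C, rescale_rescale]
  congr 1
  refine Fintype.prod_equiv (Equiv.mulRight ω) _ _ fun ζ' => ?_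
  by_cases hz : ζ' = ζ
  · simp [hz]
  · simp [hz, rescale_rescale]

theorem PowerSeries.eval_rootInterp (n : ℕ) [NeZero n] (y h : ℂ⟦X⟧) :
    (rootInterp n y h).eval y = h * ∏ ζ' : rootsOfUnity n ℂ, if ζ' = 1 then 1 else
      (y - rescale ((ζ' : ℂˣ) : ℂ) y) := by
  unfold rootInterp
  rw [Polynomial.eval_finsetSum, Finset.sum_eq_single 1]
  · rw [Polynomial.eval_mul, Polynomial.eval_prod, Polynomial.eval_C]
    congr 1
    · simp
    · refine Finset.prod_congr rfl fun ζ _ => ?_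
      split_ifs <;> simp
  · intro ζ _ hζ
    rw [Polynomial.eval_mul, Polynomial.eval_prod]
    refine mul_eq_zero_of_right _ (Finset.prod_eq_zero (Finset.mem_univ 1) ?_)
    simp [Ne.symm hζ]
  · simp

/-- By invariance under a primitive root ω, a coefficient a of X^j satisfies ω^j a = a. Thus the
coefficients of the interpolation polynomial are series in X^n. -/
theorem PowerSeries.coeff_coeff_rootInterp (n : ℕ) [NeZero n] (y h : ℂ⟦X⟧) (k j : ℕ)
    (hj : ¬ n ∣ j) : coeff j ((rootInterp n y h).coeff k) = 0 := by
  have hp := Complex.isPrimitiveRoot_exp n (NeZero.ne n)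
  have h1 := congrArg (fun p => coeff j (p.coeff k))
    (map_rescale_rootInterp n y h hp.toRootsOfUnity)
  simp only [Polynomial.coeff_map, coeff_rescale, IsPrimitiveRoot.val_toRootsOfUnity_coe] at h1
  have h2 : Complex.exp (2 * Real.pi * Complex.I / n) ^ j ≠ 1 := fun h =>
    hj (hp.dvd_of_pow_eq_one j h)
  by_contra h3
  exact h2 (mul_right_cancel₀ h3 (h1.trans (one_mul _).symm))

/-- A subalgebra of `ℂ⟦X⟧` that contains `X ^ n` and a series `y` whose conjugates are distinct
contains series of all sufficiently large orders. -/
theorem PowerSeries.exists_mem_order_eq (A : Subalgebra ℂ ℂ⟦X⟧) (n : ℕ) (hn : n ≠ 0)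
    (hX : X ^ n ∈ A) (y : ℂ⟦X⟧) (hy : y ∈ A)
    (hne : ∀ ζ : ℂ, ζ ^ n = 1 → ζ ≠ 1 → rescale ζ y ≠ y) :
    ∃ N : ℕ, ∀ m, N ≤ m → ∃ a ∈ A, a.order = m := by
  have : NeZero n := ⟨hn⟩
  obtain ⟨D, hD⟩ : ∃ D, D = ∏ ζ' : rootsOfUnity n ℂ, if ζ' = 1 then 1 else
      (y - rescale ((ζ' : ℂˣ) : ℂ) y) := ⟨_, rfl⟩
  have hD0 : D ≠ 0 := by
    rw [hD, Finset.prod_ne_zero_iff]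
    intro ζ _
    split_ifs with hz
    · exact one_ne_zero
    · refine sub_ne_zero.2 (hne _ ?_ ?_).symm
      · rw [← Units.val_pow_eq_pow_val, (mem_rootsOfUnity n _).1 ζ.2, Units.val_one]
      · simpa using hz
  obtain ⟨d, hd⟩ := ENat.ne_top_iff_exists.1 (mt order_eq_top.1 hD0)
  refine ⟨d, fun m hm => ?_⟩
  obtain ⟨l, rfl⟩ := Nat.exists_eq_add_of_le hm
  set p := rootInterp n y (X ^ l) with hp
  have hev : p.eval y = X ^ l * D := by rw [hp, eval_rootInterp, hD]
  -- Only polynomials in X^n are known to lie in A, so the coefficients are truncated. Cutting just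
  -- above degree d + l, the order of X^l * D, leaves that order unchanged.
  have htr : ∀ k, ((trunc (d + l + 1) (p.coeff k) : Polynomial ℂ) : ℂ⟦X⟧) ∈ A := by
    intro k
    have : ((trunc (d + l + 1) (p.coeff k) : Polynomial ℂ) : ℂ⟦X⟧) =
        ∑ j ∈ Finset.range (d + l + 1), coeff j (p.coeff k) • (X : ℂ⟦X⟧) ^ j := by
      ext i
      simp [coeff_trunc, coeff_X_pow]
    rw [this]
    refine A.sum_mem fun j _ => ?_
    by_cases hj : n ∣ j
    · obtain ⟨e, rfl⟩ := hj
      rw [pow_mul]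
      exact A.smul_mem (A.pow_mem hX e) _
    · rw [coeff_coeff_rootInterp n y _ k j hj, zero_smul]
      exact A.zero_mem
  refine ⟨∑ k ∈ Finset.range (p.natDegree + 1),
    ((trunc (d + l + 1) (p.coeff k) : Polynomial ℂ) : ℂ⟦X⟧) * y ^ k,
    A.sum_mem fun k _ => A.mul_mem (htr k) (A.pow_mem hy k), ?_⟩
  have hdvd : (X : ℂ⟦X⟧) ^ (d + l + 1) ∣ p.eval y - ∑ k ∈ Finset.range (p.natDegree + 1),
      ((trunc (d + l + 1) (p.coeff k) : Polynomial ℂ) : ℂ⟦X⟧) * y ^ k := by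
    rw [Polynomial.eval_eq_sum_range, ← Finset.sum_sub_distrib]
    refine Finset.dvd_sum fun k _ => ?_
    rw [← sub_mul]
    refine dvd_mul_of_dvd_left (X_pow_dvd_iff.2 fun j hj => ?_) _
    rw [map_sub, Polynomial.coeff_coe, coeff_trunc, if_pos hj, sub_self]
  have hc := X_pow_dvd_iff.1 hdvd
  have hord : (X ^ l * D).order = ((d + l : ℕ) : ℕ∞) := by
    rw [order_mul, order_X_pow, ← hd, add_comm]; norm_cast
  rw [hev] at hc
  obtain ⟨h1, h2⟩ := order_eq_nat.1 hord
  refine order_eq_nat.2 ⟨?_, fun i hi => ?_⟩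
  · have := hc (d + l) (by omega)
    rw [map_sub, sub_eq_zero] at this
    rwa [← this]
  · have := hc i (by omega)
    rw [map_sub, sub_eq_zero] at this
    rw [← this, h2 i hi]

end

/-! ### Polynomials acting on Laurent series infinite in all directions -/

noncomputable section

namespace PlaneCurveSing

variable {r : ℕ}

theorem polyMul_eq_sum_of_subset (p : MvPolynomial (Fin r) ℤ) (L : Laurent r)
    {S : Finset (Fin r →₀ ℕ)} (hS : p.support ⊆ S) (v : Fin r → ℤ) :
    polyMul p L v = ∑ m ∈ S, p.coeff m * L fun i => v i - (m i : ℤ) := by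
  refine Finset.sum_subset hS fun m _ hm => ?_
  rw [MvPolynomial.notMem_support_iff.1 hm, zero_mul]

theorem polyMul_add (p q : MvPolynomial (Fin r) ℤ) (L : Laurent r) :
    polyMul (p + q) L = polyMul p L + polyMul q L := by
  classical
  funext v
  rw [Pi.add_apply, polyMul_eq_sum_of_subset (p + q) L MvPolynomial.support_add,
    polyMul_eq_sum_of_subset p L Finset.subset_union_left,
    polyMul_eq_sum_of_subset q L Finset.subset_union_right, ← Finset.sum_add_distrib]
  simp only [MvPolynomial.coeff_add, add_mul]

theorem polyMul_add_right (p : MvPolynomial (Fin r) ℤ) (L M : Laurent r) :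
    polyMul p (L + M) = polyMul p L + polyMul p M := by
  funext v
  simp only [polyMul, Pi.add_apply, mul_add, Finset.sum_add_distrib]

theorem polyMul_monomial (m : Fin r →₀ ℕ) (a : ℤ) (L : Laurent r) :
    polyMul (MvPolynomial.monomial m a) L = fun v => a * L fun i => v i - (m i : ℤ) := by
  classical
  funext v
  rw [polyMul_eq_sum_of_subset _ L MvPolynomial.support_monomial_subset]
  simp

theorem polyMul_mul (p q : MvPolynomial (Fin r) ℤ) (L : Laurent r) :
    polyMul (p * q) L = polyMul p (polyMul q L) := by
  induction p using MvPolynomial.induction_on' with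
  | add p₁ p₂ h₁ h₂ => rw [add_mul, polyMul_add, h₁, h₂, polyMul_add]
  | monomial m a =>
    induction q using MvPolynomial.induction_on' with
    | add q₁ q₂ h₁ h₂ => rw [mul_add, polyMul_add, h₁, h₂, polyMul_add, polyMul_add_right]
    | monomial n b =>
      rw [MvPolynomial.monomial_mul, polyMul_monomial, polyMul_monomial, polyMul_monomial]
      funext v
      rw [mul_assoc]
      congr 3
      funext i
      simp only [Finsupp.add_apply, Nat.cast_add, sub_sub]

theorem polyMul_sub_one (p : MvPolynomial (Fin r) ℤ) (L : Laurent r) :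
    polyMul (p - 1) L = polyMul p L - L := by
  have h1 : polyMul 1 L = L := by
    rw [← MvPolynomial.C_1, ← MvPolynomial.monomial_zero', polyMul_monomial]
    simp
  have h2 := polyMul_add (p - 1) 1 L
  rw [sub_add_cancel, h1] at h2
  exact eq_sub_of_add_eq h2.symm

theorem polyMul_X_sub_one (i : Fin r) (L : Laurent r) (v : Fin r → ℤ) :
    polyMul (MvPolynomial.X i - 1) L v = L (v - Pi.single i 1) - L v := by
  rw [polyMul_sub_one, MvPolynomial.X, polyMul_monomial]
  simp only [Pi.sub_apply, one_mul]
  congr 2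
  funext j
  by_cases h : j = i
  · subst h; simp
  · simp [h]

theorem polyMul_tProdSubOne (L : Laurent r) (v : Fin r → ℤ) :
    polyMul (tProdSubOne r) L v = L (v - 1) - L v := by
  have h : (∏ i : Fin r, MvPolynomial.X i : MvPolynomial (Fin r) ℤ) =
      MvPolynomial.monomial (Finsupp.equivFunOnFinite.symm fun _ => 1) 1 := by
    rw [MvPolynomial.monomial_eq, Finsupp.prod_fintype _ _ (by simp)]
    simp
  rw [tProdSubOne, polyMul_sub_one, h, polyMul_monomial]
  simp only [Pi.sub_apply, one_mul]
  congr 2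

theorem ofPoly_add (p q : MvPolynomial (Fin r) ℤ) : ofPoly (p + q) = ofPoly p + ofPoly q := by
  funext v
  simp only [ofPoly, Pi.add_apply, MvPolynomial.coeff_add]
  split_ifs <;> simp

theorem ofPoly_mul (p q : MvPolynomial (Fin r) ℤ) : ofPoly (p * q) = polyMul p (ofPoly q) := by
  classical
  induction p using MvPolynomial.induction_on' with
  | add p₁ p₂ h₁ h₂ => rw [add_mul, ofPoly_add, h₁, h₂, polyMul_add]
  | monomial m a =>
    rw [polyMul_monomial]
    funext v
    simp only [ofPoly, MvPolynomial.coeff_monomial_mul']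
    by_cases hv : ∀ i, 0 ≤ v i - (m i : ℤ)
    · have hv' : ∀ i, 0 ≤ v i := fun i => by have := hv i; omega
      have hle : m ≤ Finsupp.equivFunOnFinite.symm fun i => (v i).toNat := by
        intro i
        have := hv i
        simp only [Finsupp.equivFunOnFinite_symm_apply_apply]
        omega
      rw [if_pos hv, if_pos hv', if_pos hle]
      congr 2
      ext i
      have := hv i
      simp only [Finsupp.tsub_apply, Finsupp.equivFunOnFinite_symm_apply_apply]
      omega
    · rw [if_neg hv, mul_zero]
      split_ifs with h1 h2
      · refine absurd (fun i => ?_) hv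
        have := h2 i
        have := h1 i
        simp only [Finsupp.equivFunOnFinite_symm_apply_apply] at *
        omega
      · rfl
      · rfl

/-- A Laurent series supported in a box `[0, N)^r` is a polynomial. -/
theorem exists_ofPoly_eq (L : Laurent r) (N : ℤ) (h0 : ∀ v i, v i < 0 → L v = 0)
    (hN : ∀ v i, N ≤ v i → L v = 0) : ∃ p : MvPolynomial (Fin r) ℤ, ofPoly p = L := by
  classical
  let S : Finset (Fin r →₀ ℕ) :=
    (Fintype.piFinset fun _ : Fin r => Finset.range N.toNat).map
      Finsupp.equivFunOnFinite.symm.toEmbedding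
  refine ⟨∑ m ∈ S, MvPolynomial.monomial m (L fun i => (m i : ℤ)), ?_⟩
  funext v
  by_cases hv : ∀ i, 0 ≤ v i
  · have hvv : (fun i => (((Finsupp.equivFunOnFinite.symm fun i => (v i).toNat) i : ℕ) : ℤ)) = v :=
      funext fun i => by simp [hv i]
    simp only [ofPoly, if_pos hv, MvPolynomial.coeff_sum, MvPolynomial.coeff_monomial,
      Finset.sum_ite_eq', hvv]
    split_ifs with hS
    · rfl
    · by_contra hne
      refine hS (Finset.mem_map.2 ⟨fun i => (v i).toNat, ?_, rfl⟩)
      refine Fintype.mem_piFinset.2 fun i => Finset.mem_range.2 ?_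
      have h1 : ¬ N ≤ v i := fun h => hne (hN v i h).symm
      have := hv i
      omega
  · simp only [ofPoly, if_neg hv]
    push Not at hv
    obtain ⟨i, hi⟩ := hv
    exact (h0 v i hi).symm

/-- If the `i`-th differences of `K` vanish for `v i < 0` and are constant for `v i ≥ N`, then
`(t_1 - 1) ⋯ (t_r - 1) · K` is a polynomial (`r > 1`). -/
theorem exists_ofPoly_eq_polyMul_prod (hr : 1 < r) (K : Laurent r) (N : ℤ) (b : Fin r → ℤ)
    (h0 : ∀ v i, v i < 0 → K (v - Pi.single i 1) - K v = 0)
    (hN : ∀ v i, N ≤ v i → K (v - Pi.single i 1) - K v = b i) :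
    ∃ p : MvPolynomial (Fin r) ℤ, ofPoly p = polyMul (∏ i, (MvPolynomial.X i - 1)) K := by
  classical
  -- The factors for i and k are made to act first. Where the i-th difference of K is constant, its
  -- k-th difference is zero; a second index k exists because r > 1.
  have key : ∀ i k : Fin r, k ≠ i → ∃ q : MvPolynomial (Fin r) ℤ,
      polyMul (∏ i, (MvPolynomial.X i - 1)) K =
        polyMul q (polyMul (MvPolynomial.X k - 1) (polyMul (MvPolynomial.X i - 1) K)) := by
    intro i k hki
    refine ⟨∏ j ∈ (Finset.univ.erase i).erase k, (MvPolynomial.X j - 1), ?_⟩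
    rw [← polyMul_mul, ← polyMul_mul, Finset.prod_erase_mul _ _ (by simp [hki]),
      Finset.prod_erase_mul _ _ (Finset.mem_univ i)]
  have hex : ∀ i : Fin r, ∃ k, k ≠ i := by
    intro i
    have : Nontrivial (Fin r) := Fin.nontrivial_iff_two_le.2 hr
    exact exists_ne i
  have hB : ∀ i : Fin r, ∃ B : ℤ, ∀ v : Fin r → ℤ, B ≤ v i →
      polyMul (∏ i, (MvPolynomial.X i - 1)) K v = 0 := by
    intro i
    obtain ⟨k, hk⟩ := hex i
    obtain ⟨q, hq⟩ := key i k hk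
    -- The factor q evaluates at v - m for m in its support; the margin keeps the i-th coordinate at
    -- least N. No margin is needed for v i < 0, since the shift only lowers it.
    refine ⟨N + ∑ m ∈ q.support, (m i : ℤ), fun v hv => ?_⟩
    rw [hq]
    refine Finset.sum_eq_zero fun m hm => ?_
    have h1 : (m i : ℤ) ≤ ∑ m ∈ q.support, (m i : ℤ) :=
      Finset.single_le_sum (f := fun m : Fin r →₀ ℕ => (m i : ℤ)) (fun _ _ => by positivity) hm
    rw [polyMul_X_sub_one, polyMul_X_sub_one, polyMul_X_sub_one, hN _ i, hN _ i, sub_self,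
      mul_zero]
    · show N ≤ v i - (m i : ℤ)
      omega
    · simp only [Pi.sub_apply, Pi.single_eq_of_ne (Ne.symm hk)]
      omega
  choose B hB using hB
  refine exists_ofPoly_eq _ (∑ i, |B i|) ?_ ?_
  · intro v i hv
    obtain ⟨k, hk⟩ := hex i
    obtain ⟨q, hq⟩ := key i k hk
    rw [hq]
    refine Finset.sum_eq_zero fun m hm => ?_
    rw [polyMul_X_sub_one, polyMul_X_sub_one, polyMul_X_sub_one, h0 _ i, h0 _ i, sub_self,
      mul_zero]
    · show v i - (m i : ℤ) < 0
      omega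
    · simp only [Pi.sub_apply, Pi.single_eq_of_ne (Ne.symm hk)]
      omega
  · intro v i hv
    refine hB i v (le_trans (le_abs_self _) (le_trans ?_ hv))
    exact Finset.single_le_sum (f := fun i => |B i|) (fun _ _ => abs_nonneg _) (Finset.mem_univ i)

theorem toPowerSeries_ofPoly (p : MvPolynomial (Fin r) ℤ) :
    toPowerSeries (ofPoly p) = (p : MvPowerSeries (Fin r) ℤ) := by
  ext m
  change ofPoly p (fun i => (m i : ℤ)) = _
  rw [MvPolynomial.coeff_coe, ofPoly, if_pos fun i => by positivity]
  congr 1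
  ext i
  simp

theorem tProdSubOne_mul_invOfUnit (hr : 0 < r) :
    (tProdSubOne r : MvPowerSeries (Fin r) ℤ) *
      MvPowerSeries.invOfUnit (tProdSubOne r : MvPowerSeries (Fin r) ℤ) (-1) = 1 := by
  refine MvPowerSeries.mul_invOfUnit _ _ ?_
  rw [← MvPowerSeries.coeff_zero_eq_constantCoeff_apply, MvPolynomial.coeff_coe,
    ← MvPolynomial.constantCoeff_eq, tProdSubOne, map_sub, map_prod]
  simp [Finset.prod_eq_zero (Finset.mem_univ (⟨0, hr⟩ : Fin r))]

end PlaneCurveSing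

end

/-! ### Codimension of a kernel; Taylor series of germs in one variable -/

noncomputable section

/-- Here p/q ≅ range f, and codimensions add along q ≤ p ≤ A. -/
theorem Submodule.finrank_quotient_of_eq_map_ker {K A W : Type*} [Field K] [AddCommGroup A]
    [Module K A] [AddCommGroup W] [Module K W] [FiniteDimensional K W] (p q : Submodule K A)
    [FiniteDimensional K (A ⧸ p)] (f : p →ₗ[K] W) (hq : (LinearMap.ker f).map p.subtype = q) :
    FiniteDimensional K (A ⧸ q) ∧
      Module.finrank K (A ⧸ q) = Module.finrank K (A ⧸ p) + Module.finrank K (LinearMap.range f) := by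
  have hle : q ≤ p := by
    rw [← hq]
    exact Submodule.map_subtype_le p _
  have hker : LinearMap.ker (q.mkQ ∘ₗ p.subtype) = LinearMap.ker f := by
    rw [LinearMap.ker_comp, Submodule.ker_mkQ, ← hq,
      Submodule.comap_map_eq_of_injective p.injective_subtype]
  have hrange : LinearMap.range (q.mkQ ∘ₗ p.subtype) = p.map q.mkQ := by
    rw [LinearMap.range_comp, Submodule.range_subtype]
  have e : p.map q.mkQ ≃ₗ[K] LinearMap.range f :=
    (LinearEquiv.ofEq _ _ hrange.symm) ≪≫ₗ (LinearMap.quotKerEquivRange _).symm ≪≫ₗ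
      (Submodule.quotEquivOfEq _ _ hker) ≪≫ₗ LinearMap.quotKerEquivRange f
  have e' := Submodule.quotientQuotientEquivQuotient q p hle
  have : FiniteDimensional K (p.map q.mkQ) := Module.Finite.equiv e.symm
  have : FiniteDimensional K ((A ⧸ q) ⧸ p.map q.mkQ) := Module.Finite.equiv e'.symm
  have hfin : FiniteDimensional K (A ⧸ q) := Module.Finite.of_submodule_quotient (p.map q.mkQ)
  refine ⟨hfin, ?_⟩
  rw [← Submodule.finrank_quotient_add_finrank (p.map q.mkQ), e.finrank_eq, e'.finrank_eq]

theorem iteratedDeriv_comp_const_mul_apply {𝕜 : Type*} [NontriviallyNormedField 𝕜] (n : ℕ)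
    (f : 𝕜 → 𝕜) (c x : 𝕜) :
    iteratedDeriv n (fun t => f (c * t)) x = c ^ n * iteratedDeriv n f (c * x) := by
  induction n generalizing x with
  | zero => simp
  | succ n ih =>
    rw [iteratedDeriv_succ, iteratedDeriv_succ, funext ih, deriv_const_mul_field,
      deriv_comp_mul_left, smul_eq_mul, pow_succ, mul_assoc]

namespace PlaneCurveSing

/-- The power series expansion at `0` of a germ in one variable. -/
def HolGerm.taylor : HolGerm ℂ →ₐ[ℂ] PowerSeries ℂ :=
  AlgHom.ofLinearMap
    { toFun := fun h => PowerSeries.mk fun n => HolGerm.coeff n h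
      map_add' := fun f g => by ext n; simp
      map_smul' := fun c f => by ext n; simp }
    (by
      ext n
      rw [PowerSeries.coeff_one]
      refine (PowerSeries.coeff_mk n fun n => HolGerm.coeff n (1 : HolGerm ℂ)).trans ?_
      change iteratedDeriv n (fun _ : ℂ => (1 : ℂ)) 0 / (n.factorial : ℂ) = _
      rw [iteratedDeriv_const]
      split_ifs with h <;> simp [h])
    (by
      rintro ⟨_, F, hF, rfl⟩ ⟨_, G, hG, rfl⟩
      ext n
      rw [PowerSeries.coeff_mul]
      simp only [LinearMap.coe_mk, AddHom.coe_mk, PowerSeries.coeff_mk]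
      change iteratedDeriv n (F * G) 0 / (n.factorial : ℂ) =
        ∑ p ∈ Finset.HasAntidiagonal.antidiagonal n,
          iteratedDeriv p.1 F 0 / (p.1.factorial : ℂ) * (iteratedDeriv p.2 G 0 / (p.2.factorial : ℂ))
      rw [iteratedDeriv_mul hF.contDiffAt hG.contDiffAt,
        Finset.Nat.sum_antidiagonal_eq_sum_range_succ_mk, Finset.sum_div]
      refine Finset.sum_congr rfl fun k hk => ?_
      have hk' : k ≤ n := Nat.lt_succ_iff.1 (Finset.mem_range.1 hk)
      rw [Nat.cast_choose ℂ hk']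
      have h1 : (n.factorial : ℂ) ≠ 0 := Nat.cast_ne_zero.2 n.factorial_ne_zero
      field_simp)

theorem HolGerm.coeff_taylor (n : ℕ) (h : HolGerm ℂ) :
    PowerSeries.coeff n (taylor h) = HolGerm.coeff n h :=
  PowerSeries.coeff_mk n fun n => HolGerm.coeff n h

theorem HolGerm.natCast_le_order_iff (n : ℕ) (h : HolGerm ℂ) :
    (n : ℕ∞) ≤ HolGerm.order h ↔ ∀ k < n, HolGerm.coeff k h = 0 := by
  obtain ⟨_, F, hF, rfl⟩ := h
  change (n : ℕ∞) ≤ analyticOrderAt F 0 ↔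
    ∀ k < n, iteratedDeriv k F 0 / (k.factorial : ℂ) = 0
  rw [natCast_le_analyticOrderAt_iff_iteratedDeriv_eq_zero hF]
  refine forall₂_congr fun k _ => ?_
  simp [Nat.factorial_ne_zero]

theorem HolGerm.order_taylor (h : HolGerm ℂ) : (taylor h).order = HolGerm.order h := by
  refine ENat.eq_of_forall_natCast_le_iff fun n => ?_
  rw [HolGerm.natCast_le_order_iff]
  refine ⟨fun hn k hk => ?_, fun hn => PowerSeries.nat_le_order _ n fun k hk => ?_⟩
  · rw [← coeff_taylor]
    exact PowerSeries.coeff_of_lt_order k (lt_of_lt_of_le (by exact_mod_cast hk) hn)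
  · rw [coeff_taylor, hn k hk]

theorem HolGerm.order_mul (g h : HolGerm ℂ) : HolGerm.order (g * h) =
    HolGerm.order g + HolGerm.order h := by
  rw [← order_taylor, map_mul, PowerSeries.order_mul, order_taylor, order_taylor]

theorem HolGerm.order_eq_top_iff (h : HolGerm ℂ) : HolGerm.order h = ⊤ ↔ h = 0 := by
  obtain ⟨_, F, hF, rfl⟩ := h
  change analyticOrderAt F 0 = ⊤ ↔ _
  rw [analyticOrderAt_eq_top]
  refine ⟨fun hz => Subtype.ext (Germ.coe_eq.2 hz), fun hz => ?_⟩
  exact Germ.coe_eq.1 (congrArg Subtype.val hz)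

/-- This turns equality of conjugate series into an identity of functions at ζs and s. -/
theorem HolGerm.taylor_comp_mul (H : ℂ → ℂ) (hH : AnalyticAt ℂ H 0) (c : ℂ)
    (hc : AnalyticAt ℂ (fun t => H (c * t)) 0) :
    taylor (HolGerm.mk (fun t => H (c * t)) hc) =
      PowerSeries.rescale c (taylor (HolGerm.mk H hH)) := by
  ext n
  rw [PowerSeries.coeff_rescale, coeff_taylor, coeff_taylor]
  change iteratedDeriv n (fun t => H (c * t)) 0 / (n.factorial : ℂ) =
    c ^ n * (iteratedDeriv n H 0 / (n.factorial : ℂ))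
  rw [iteratedDeriv_comp_const_mul_apply, mul_zero, mul_div_assoc]

theorem HolGerm.taylor_injective : Function.Injective taylor := by
  refine (injective_iff_map_eq_zero _).2 fun h hh => ?_
  rw [← order_eq_top_iff, ← order_taylor, hh, PowerSeries.order_zero]

theorem HolGerm.taylor_id : taylor (HolGerm.mk (fun t => t) analyticAt_id) = PowerSeries.X := by
  ext n
  rw [PowerSeries.coeff_X, coeff_taylor]
  change iteratedDeriv n (fun t : ℂ => t) 0 / (n.factorial : ℂ) = _
  rcases n with _ | _ | n
  · simp
  · simp
  · simp [iteratedDeriv_succ']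

end PlaneCurveSing

end

/-! ### The codimension function of the ideals J(v) -/

noncomputable section

theorem LinearMap.finiteDimensional_quotient_ker {K A W : Type*} [Field K] [AddCommGroup A]
    [Module K A] [AddCommGroup W] [Module K W] [FiniteDimensional K W] (f : A →ₗ[K] W) :
    FiniteDimensional K (A ⧸ LinearMap.ker f) :=
  Module.Finite.equiv f.quotKerEquivRange.symm

namespace PlaneCurveSing

variable {r : ℕ}

theorem PlaneCurve.mem_J_iff (C : PlaneCurve r) (φ : ∀ i, Parametrization (C.comp i))
    (v : Fin r → ℤ) (g : C.Ring) :
    g ∈ C.J φ v ↔ ∀ i, ∀ k : ℕ, (k : ℤ) < v i → HolGerm.coeff k (C.restrict (φ i) g) = 0 := by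
  change (∀ i, ((v i).toNat : ℕ∞) ≤ HolGerm.order (C.restrict (φ i) g)) ↔ _
  refine forall_congr' fun i => ?_
  rw [HolGerm.natCast_le_order_iff]
  refine forall_congr' fun k => ?_
  rw [Int.lt_toNat]

/-- The ideal `J(v)` as a `ℂ`-linear subspace of `𝒪_C`. -/
abbrev PlaneCurve.JSubspace (C : PlaneCurve r) (φ : ∀ i, Parametrization (C.comp i))
    (v : Fin r → ℤ) : Submodule ℂ C.Ring :=
  (C.J φ v).restrictScalars ℂ

instance PlaneCurve.finiteDimensional_quotient_J (C : PlaneCurve r)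
    (φ : ∀ i, Parametrization (C.comp i)) (v : Fin r → ℤ) :
    FiniteDimensional ℂ (C.Ring ⧸ C.JSubspace φ v) := by
  let f : C.Ring →ₗ[ℂ] (∀ i, Fin (v i).toNat → ℂ) :=
    LinearMap.pi fun i => LinearMap.pi fun k =>
      HolGerm.coeff (k : ℕ) ∘ₗ (C.restrict (φ i)).toLinearMap
  have hf : LinearMap.ker f = C.JSubspace φ v := by
    ext g
    rw [LinearMap.mem_ker, Submodule.restrictScalars_mem, C.mem_J_iff]
    constructor
    · intro h i k hk
      exact congrFun (congrFun h i) ⟨k, Int.lt_toNat.2 hk⟩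
    · intro h
      funext i k
      exact h i k (Int.lt_toNat.1 k.2)
  rw [← hf]
  exact LinearMap.finiteDimensional_quotient_ker f

/-- `h(v) = dim 𝒪_C / J(v)`. -/
def PlaneCurve.h (C : PlaneCurve r) (φ : ∀ i, Parametrization (C.comp i)) (v : Fin r → ℤ) : ℕ :=
  Module.finrank ℂ (C.Ring ⧸ C.JSubspace φ v)

/-- The kernel of j_v is J(v+1): the coefficients of t^{v_i} are the only additional conditions, and
those with v_i < 0 are vacuous. -/
theorem PlaneCurve.h_add_one (C : PlaneCurve r) (φ : ∀ i, Parametrization (C.comp i))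
    (v : Fin r → ℤ) : C.h φ (v + 1) = C.h φ v + C.c φ v := by
  refine (Submodule.finrank_quotient_of_eq_map_ker (C.JSubspace φ v) _ (C.j φ v) ?_).2
  ext g
  rw [Submodule.mem_map, Submodule.restrictScalars_mem, C.mem_J_iff]
  constructor
  · rintro ⟨⟨g, hg⟩, hg0, rfl⟩ i k hk
    rw [Submodule.restrictScalars_mem, C.mem_J_iff] at hg
    rcases lt_or_eq_of_le (Int.lt_add_one_iff.1 hk) with hlt | heq
    · exact hg i k hlt
    · have h1 : HolGerm.zcoeff (v i) (C.restrict (φ i) g) = 0 := congrFun hg0 i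
      rwa [← heq, HolGerm.zcoeff, if_pos (by positivity), Int.toNat_natCast] at h1
  · intro hg
    have hgv : g ∈ C.J φ v := (C.mem_J_iff φ v g).2 fun i k hk =>
      hg i k (hk.trans (by simp))
    refine ⟨⟨g, hgv⟩, ?_, rfl⟩
    rw [LinearMap.mem_ker]
    funext i
    change HolGerm.zcoeff (v i) (C.restrict (φ i) g) = 0
    rw [HolGerm.zcoeff]
    split_ifs with h0
    · refine hg i _ ?_
      rw [Int.toNat_of_nonneg h0]
      simp
    · rfl

theorem PlaneCurve.h_add_single_of_neg (C : PlaneCurve r) (φ : ∀ i, Parametrization (C.comp i))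
    (v : Fin r → ℤ) (i : Fin r) (hv : v i < 0) : C.h φ (v + Pi.single i 1) = C.h φ v := by
  have hJ : C.J φ (v + Pi.single i 1) = C.J φ v := by
    ext g
    rw [C.mem_J_iff, C.mem_J_iff]
    refine forall₂_congr fun l k => ?_
    have : (k : ℤ) < (v + Pi.single i 1 : Fin r → ℤ) l ↔ (k : ℤ) < v l := by
      by_cases hl : l = i
      · subst hl
        simp only [Pi.add_apply, Pi.single_eq_same]
        omega
      · simp [hl]
    rw [this]
  unfold PlaneCurve.h PlaneCurve.JSubspace
  rw [hJ]

/-- J(v + e_i) is the kernel in J(v) of the n-th coefficient on branch i; the function g makes this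
functional nonzero, hence onto ℂ. -/
theorem PlaneCurve.h_add_single_of_mem (C : PlaneCurve r) (φ : ∀ i, Parametrization (C.comp i))
    (v : Fin r → ℤ) (i : Fin r) (n : ℕ) (hv : v i = n) (g : C.Ring) (hg : g ∈ C.J φ v)
    (hgn : HolGerm.coeff n (C.restrict (φ i) g) ≠ 0) :
    C.h φ (v + Pi.single i 1) = C.h φ v + 1 := by
  let f : C.JSubspace φ v →ₗ[ℂ] ℂ :=
    HolGerm.coeff n ∘ₗ (C.restrict (φ i)).toLinearMap ∘ₗ (C.JSubspace φ v).subtype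
  have hf : LinearMap.range f = ⊤ := by
    refine LinearMap.range_eq_top.2 (LinearMap.surjective_iff_ne_zero.2 fun h0 => hgn ?_)
    exact LinearMap.congr_fun h0 (⟨g, hg⟩ : C.JSubspace φ v)
  have key := (Submodule.finrank_quotient_of_eq_map_ker (C.JSubspace φ v)
    (C.JSubspace φ (v + Pi.single i 1)) f ?_).2
  · rwa [hf, finrank_top, Module.finrank_self] at key
  ext g
  rw [Submodule.mem_map, Submodule.restrictScalars_mem, C.mem_J_iff]
  constructor
  · rintro ⟨⟨g, hg⟩, hg0, rfl⟩ l k hk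
    rw [Submodule.restrictScalars_mem, C.mem_J_iff] at hg
    by_cases hl : l = i
    · subst hl
      rw [Pi.add_apply, Pi.single_eq_same] at hk
      rcases lt_or_eq_of_le (Int.lt_add_one_iff.1 hk) with hlt | heq
      · exact hg l k hlt
      · rw [hv] at heq
        rw [Nat.cast_injective heq]
        exact hg0
    · rw [Pi.add_apply, Pi.single_eq_of_ne hl, add_zero] at hk
      exact hg l k hk
  · intro hg
    have hgv : g ∈ C.J φ v := (C.mem_J_iff φ v g).2 fun l k hk =>
      hg l k (lt_of_lt_of_le hk (by
        rw [Pi.add_apply]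
        by_cases hl : l = i
        · subst hl; simp
        · simp [hl]))
    refine ⟨⟨g, hgv⟩, ?_, rfl⟩
    exact hg i n (by rw [Pi.add_apply, Pi.single_eq_same, hv]; omega)

/-- A curve admitting functions with all sufficiently large orders on one component and vanishing
on the others satisfies the conclusion on its Poincaré series. -/
theorem PlaneCurve.exists_poly_of_exists_order (hr : 1 < r) (C : PlaneCurve r)
    (φ : ∀ i, Parametrization (C.comp i))
    (H : ∀ i, ∃ N : ℕ, ∀ m : ℕ, N ≤ m → ∃ g : C.Ring, C.v φ i g = m ∧ ∀ l ≠ i, C.v φ l g = ⊤) :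
    ∃ Q' Q : MvPolynomial (Fin r) ℤ, ofPoly Q' = C.P' φ ∧ Q' = tProdSubOne r * Q ∧
      C.P φ = (Q : MvPowerSeries (Fin r) ℤ) := by
  choose N hN using H
  -- The shift by 1 and the sign give K(v - 1) - K(v) = h(v+1) - h(v) = c(v).
  let K : Laurent r := fun v => -(C.h φ (v + 1) : ℤ)
  have hL : polyMul (tProdSubOne r) K = C.L φ := by
    funext v
    rw [polyMul_tProdSubOne]
    simp only [K, PlaneCurve.L]
    rw [sub_add_cancel, C.h_add_one]
    push_cast
    ring
  have hsub : ∀ (v : Fin r → ℤ) (i : Fin r), v + 1 = (v - Pi.single i 1 + 1) + Pi.single i 1 :=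
    fun v i => by abel
  have hKi : ∀ (v : Fin r → ℤ) (i : Fin r), (v - Pi.single i 1 + 1 : Fin r → ℤ) i = v i :=
    fun v i => by simp
  have h0 : ∀ v i, v i < 0 → K (v - Pi.single i 1) - K v = 0 := by
    intro v i hv
    simp only [K]
    rw [hsub v i, C.h_add_single_of_neg φ _ i (by rwa [hKi])]
    simp
  have hN1 : ∀ (v : Fin r → ℤ) i, ∑ i, (N i : ℤ) ≤ v i → K (v - Pi.single i 1) - K v = 1 := by
    intro v i hv
    have hNi : (N i : ℤ) ≤ v i := le_trans
      (Finset.single_le_sum (f := fun i => (N i : ℤ)) (fun _ _ => by positivity)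
        (Finset.mem_univ i)) hv
    obtain ⟨m, hm⟩ := Int.eq_ofNat_of_zero_le (le_trans (by positivity) hNi)
    obtain ⟨g, hgi, hgl⟩ := hN i m (by omega)
    simp only [K]
    rw [hsub v i, C.h_add_single_of_mem φ _ i m (by rwa [hKi]) g]
    · push_cast
      ring
    · intro l
      by_cases hl : l = i
      · subst hl
        rw [hgi, hKi, hm, Int.toNat_natCast]
      · rw [hgl l hl]
        exact le_top
    · intro h0
      have h1 : ((m + 1 : ℕ) : ℕ∞) ≤ HolGerm.order (C.restrict (φ i) g) := by
        refine (HolGerm.natCast_le_order_iff _ _).2 fun k hk => ?_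
        rcases Nat.lt_succ_iff_lt_or_eq.1 hk with hlt | rfl
        · exact (HolGerm.natCast_le_order_iff m _).1 hgi.ge k hlt
        · exact h0
      have h2 : HolGerm.order (C.restrict (φ i) g) = m := hgi
      rw [h2] at h1
      exact absurd (Nat.cast_le.1 h1) (by omega)
  obtain ⟨Q, hQ⟩ := exists_ofPoly_eq_polyMul_prod hr K (∑ i, (N i : ℤ)) (fun _ => 1) h0 hN1
  have hQ' : ofPoly (tProdSubOne r * Q) = C.P' φ := by
    rw [ofPoly_mul, hQ, PlaneCurve.P', ← hL, ← polyMul_mul, ← polyMul_mul, mul_comm]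
  refine ⟨_, Q, hQ', rfl, ?_⟩
  rw [PlaneCurve.P, ← hQ', toPowerSeries_ofPoly, MvPolynomial.coe_mul, mul_right_comm,
    tProdSubOne_mul_invOfUnit (by omega), one_mul]

end PlaneCurveSing

end

/-! ### Orders of functions along a branch; separating the branches -/

noncomputable section

/-- An analytic function of one variable with an isolated zero at `0` is a power of the variable in
a suitable local coordinate. -/
theorem AnalyticAt.exists_comp_eventuallyEq_pow {x : ℂ → ℂ} (hx : AnalyticAt ℂ x 0) (h0 : x 0 = 0)
    (hne : ¬ ∀ᶠ t in 𝓝 0, x t = 0) :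
    ∃ n : ℕ, n ≠ 0 ∧ ∃ ψ : ℂ → ℂ, AnalyticAt ℂ ψ 0 ∧ ψ 0 = 0 ∧ deriv ψ 0 ≠ 0 ∧
      ∀ᶠ s in 𝓝 0, x (ψ s) = s ^ n := by
  obtain ⟨n, hn⟩ := ENat.ne_top_iff_exists.1 (mt analyticOrderAt_eq_top.1 hne)
  obtain ⟨u, hu, hu0, hxu⟩ := hx.analyticOrderAt_eq_natCast.1 hn.symm
  have hn0 : n ≠ 0 := by
    rintro rfl
    have := hxu.self_of_nhds
    rw [h0, pow_zero, one_smul] at this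
    exact hu0 this.symm
  obtain ⟨c, hc⟩ := IsAlgClosed.exists_pow_nat_eq (u 0) (Nat.pos_of_ne_zero hn0)
  have hc0 : c ≠ 0 := by
    rintro rfl
    rw [zero_pow hn0] at hc
    exact hu0 hc.symm
  -- An analytic n-th root of u near 0; dividing by u 0 moves the argument of the logarithm near 1,
  -- away from the cut. The new coordinate is w = z * q z, with w^n = x, and ψ is its local inverse.
  let q : ℂ → ℂ := fun z => c * Complex.exp (Complex.log (u z / u 0) / n)
  have hq : AnalyticAt ℂ q 0 := by
    refine analyticAt_const.mul (AnalyticAt.cexp (AnalyticAt.div_const (AnalyticAt.clog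
      (AnalyticAt.div_const hu) ?_)))
    rw [div_self hu0]
    exact Complex.one_mem_slitPlane
  have hq0 : q 0 = c := by simp [q, hu0]
  have hqn : ∀ᶠ z in 𝓝 0, q z ^ n = u z := by
    filter_upwards [hu.continuousAt.eventually_ne hu0] with z hz
    have hn' : (n : ℂ) ≠ 0 := Nat.cast_ne_zero.2 hn0
    simp only [q]
    rw [mul_pow, hc, ← Complex.exp_nat_mul, mul_div_cancel₀ _ hn',
      Complex.exp_log (div_ne_zero hz hu0), mul_div_cancel₀ _ hu0]
  let w : ℂ → ℂ := fun z => z * q z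
  have hw : AnalyticAt ℂ w 0 := analyticAt_id.mul hq
  have hw0 : w 0 = 0 := zero_mul _
  have hwd : HasDerivAt w c 0 := by
    have := (hasDerivAt_id (0 : ℂ)).mul hq.differentiableAt.hasDerivAt
    refine HasDerivAt.congr_deriv (f := w) this ?_
    simp [hq0]
  have hwd' : deriv w 0 ≠ 0 := by rwa [hwd.deriv]
  let ψ := hw.hasStrictDerivAt.localInverse w (deriv w 0) 0 hwd'
  have hψa : AnalyticAt ℂ ψ (w 0) := hw.analyticAt_localInverse hwd'
  have hψ0 : ψ (w 0) = 0 := HasStrictFDerivAt.localInverse_apply_image ..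
  have hψd : HasStrictDerivAt ψ (deriv w 0)⁻¹ (w 0) := hw.hasStrictDerivAt.to_localInverse hwd'
  have hr : ∀ᶠ s in 𝓝 (w 0), w (ψ s) = s := HasStrictDerivAt.eventually_right_inverse ..
  rw [hw0] at hψa hψ0 hψd hr
  refine ⟨n, hn0, ψ, hψa, hψ0, ?_, ?_⟩
  · rw [hψd.hasDerivAt.deriv]
    exact inv_ne_zero hwd'
  · have ht : Tendsto ψ (𝓝 0) (𝓝 0) := by
      have := hψa.continuousAt.tendsto
      rwa [hψ0] at this
    filter_upwards [hr, ht.eventually hxu, ht.eventually hqn] with s h1 h2 h3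
    rw [h2, sub_zero, smul_eq_mul, ← h3, ← mul_pow]
    exact congrArg (· ^ n) h1

namespace PlaneCurveSing

variable {r : ℕ}

/-- The orders of functions along an injectively parametrized branch contain all large integers
(case of a non-constant coordinate function `P`). -/
theorem exists_order_pullback_eq_of_coord {φ : ℂ → ℂ × ℂ} (hφ : AnalyticAt ℂ φ 0) (h0 : φ 0 = 0)
    (hinj : ∃ U ∈ 𝓝 (0 : ℂ), Set.InjOn φ U) {P Q : ℂ × ℂ → ℂ} (hP : AnalyticAt ℂ P 0)
    (hQ : AnalyticAt ℂ Q 0) (hP0 : P 0 = 0) (hPQ : ∀ a b, P a = P b → Q a = Q b → a = b)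
    (hne : ¬ ∀ᶠ t in 𝓝 0, P (φ t) = 0) :
    ∃ N : ℕ, ∀ m, N ≤ m → ∃ g, HolGerm.order (pullback φ hφ h0 g) = m := by
  have hPφ : AnalyticAt ℂ (fun t => P (φ t)) 0 := AnalyticAt.fun_comp (by rwa [h0]) hφ
  obtain ⟨n, hn, ψ, hψ, hψ0, hψd, hpow⟩ :=
    hPφ.exists_comp_eventuallyEq_pow (by rw [h0, hP0]) hne
  have hφψ : AnalyticAt ℂ (φ ∘ ψ) 0 := AnalyticAt.comp (by rwa [hψ0]) hψ
  have hφψ0 : (φ ∘ ψ) 0 = 0 := by rw [Function.comp_apply, hψ0, h0]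
  have htψ : Tendsto ψ (𝓝 0) (𝓝 0) := by
    have := hψ.continuousAt.tendsto
    rwa [hψ0] at this
  have hy : AnalyticAt ℂ (fun s => Q (φ (ψ s))) 0 :=
    AnalyticAt.comp (f := φ ∘ ψ) (g := Q) (by rwa [hφψ0]) hφψ
  have hX : PowerSeries.X ^ n ∈ (HolGerm.taylor.comp (pullback (φ ∘ ψ) hφψ hφψ0)).range := by
    have hPn : pullback (φ ∘ ψ) hφψ hφψ0 (HolGerm.mk P hP) =
        HolGerm.mk (fun t => t) analyticAt_id ^ n :=
      Subtype.ext (Germ.coe_eq.2 hpow)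
    refine ⟨HolGerm.mk P hP, ?_⟩
    rw [← HolGerm.taylor_id, ← map_pow, ← hPn]
    rfl
  -- If two conjugates agreed, P and Q would take equal values at φ(ψ(ζs)) and φ(ψ(s)). Injectivity
  -- of φ would give ψ(ζs) = ψ(s), and differentiating at 0 would force ζ = 1.
  have hζ : ∀ ζ : ℂ, ζ ^ n = 1 → ζ ≠ 1 →
      PowerSeries.rescale ζ (HolGerm.taylor (HolGerm.mk _ hy)) ≠ HolGerm.taylor (HolGerm.mk _ hy) := by
    intro ζ hζ hζ1 hres
    have hmul : Tendsto (fun s : ℂ => ζ * s) (𝓝 0) (𝓝 0) := by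
      have : ContinuousAt (fun s : ℂ => ζ * s) 0 := by fun_prop
      simpa [ContinuousAt] using this
    have hyζ : AnalyticAt ℂ (fun s => Q (φ (ψ (ζ * s)))) 0 :=
      AnalyticAt.comp (f := fun s : ℂ => ζ * s) (g := fun s => Q (φ (ψ s))) (by simpa using hy)
        (by fun_prop)
    rw [← HolGerm.taylor_comp_mul _ hy ζ hyζ] at hres
    have hQeq : ∀ᶠ s in 𝓝 0, Q (φ (ψ (ζ * s))) = Q (φ (ψ s)) :=
      Germ.coe_eq.1 (congrArg Subtype.val (HolGerm.taylor_injective hres))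
    obtain ⟨U, hU, hUinj⟩ := hinj
    have hψeq : (fun s => ψ (ζ * s)) =ᶠ[𝓝 0] ψ := by
      filter_upwards [hQeq, hpow, hmul.eventually hpow, htψ hU, hmul.eventually (htψ hU)] with
        s h1 h2 h3 h4 h5
      refine hUinj h5 h4 (hPQ _ _ ?_ h1)
      rw [h3, h2, mul_pow, hζ, one_mul]
    have hd := hψeq.deriv_eq
    rw [deriv_comp_mul_left, mul_zero, smul_eq_mul] at hd
    exact hζ1 (mul_right_cancel₀ hψd (hd.trans (one_mul _).symm))
  obtain ⟨N, hN⟩ := PowerSeries.exists_mem_order_eq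
    (HolGerm.taylor.comp (pullback (φ ∘ ψ) hφψ hφψ0)).range n hn hX
    (HolGerm.taylor (HolGerm.mk _ hy)) ⟨HolGerm.mk Q hQ, rfl⟩ hζ
  refine ⟨N, fun m hm => ?_⟩
  obtain ⟨_, ⟨g, rfl⟩, hg⟩ := hN m hm
  refine ⟨g, ?_⟩
  rw [← hg]
  -- Orders do not change under ψ, since its derivative at 0 is nonzero.
  refine Eq.symm ((HolGerm.order_taylor _).trans ?_)
  obtain ⟨_, G, hG, rfl⟩ := g
  change analyticOrderAt ((G ∘ φ) ∘ ψ) 0 = analyticOrderAt (G ∘ φ) 0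
  rw [analyticOrderAt_comp_of_deriv_ne_zero hψ hψd, hψ0]

/-- One of the two coordinates is not identically zero along φ, because φ is immersive off 0. -/
theorem Parametrization.exists_order_pullback_eq {Z : Set (ℂ × ℂ)} (p : Parametrization Z) :
    ∃ N : ℕ, ∀ m, N ≤ m → ∃ g, HolGerm.order (pullback p.φ p.analytic p.map_zero g) = m := by
  by_cases h : ∀ᶠ t in 𝓝 0, (p.φ t).1 = 0
  · refine exists_order_pullback_eq_of_coord p.analytic p.map_zero p.injective (P := Prod.snd)
      (Q := Prod.fst) analyticAt_snd analyticAt_fst rfl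
      (fun a b h1 h2 => Prod.ext h2 h1) fun h' => ?_
    have hz : p.φ =ᶠ[𝓝 0] fun _ => 0 := by
      filter_upwards [h, h'] with t h1 h2
      exact Prod.ext h1 h2
    obtain ⟨t, ht⟩ :=
      p.immersive.and (hz.eventuallyEq_nhds.filter_mono nhdsWithin_le_nhds) |>.exists
    exact ht.1 (by rw [ht.2.deriv_eq, deriv_const])
  · exact exists_order_pullback_eq_of_coord p.analytic p.map_zero p.injective (P := Prod.fst)
      (Q := Prod.snd) analyticAt_fst analyticAt_snd rfl (fun a b => Prod.ext) h

/-- If the analytic germ `Z'` does not contain `Z`, some holomorphic function vanishes on `Z'` but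
not on `Z`. -/
theorem Parametrization.exists_pullback_eq_zero_ne_zero {Z Z' : Set (ℂ × ℂ)}
    (p : Parametrization Z) (p' : Parametrization Z') (hZ' : IsAnalyticGerm Z')
    (hZ : ¬ ∀ᶠ x in 𝓝 (0 : ℂ × ℂ), x ∈ Z → x ∈ Z') :
    ∃ g, pullback p'.φ p'.analytic p'.map_zero g = 0 ∧
      pullback p.φ p.analytic p.map_zero g ≠ 0 := by
  obtain ⟨k, h, hh, hk⟩ := hZ'
  by_contra hcon
  push Not at hcon
  have hmem := eventuallyEq_set.1 hk
  -- Otherwise the equations of Z', which vanish on Z', would all vanish on Z as well, forcing Z ⊆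
  -- Z' near 0.
  have h1 : ∀ j, ∀ᶠ t in 𝓝 (0 : ℂ), h j (p.φ t) = 0 := by
    intro j
    refine Germ.coe_eq.1 (congrArg Subtype.val (hcon (HolGerm.mk (h j) (hh j)) ?_))
    refine Subtype.ext (Germ.coe_eq.2 ?_)
    have h2 : ∀ᶠ x in 𝓝[Z'] (0 : ℂ × ℂ), h j x = 0 := by
      refine eventually_nhdsWithin_iff.2 ?_
      filter_upwards [hmem] with x hx hxZ
      exact hx.1 hxZ j
    rw [← p'.image_eq] at h2
    exact Filter.eventually_map.1 h2
  have ht : Tendsto p.φ (𝓝 0) (𝓝 0) := by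
    have := p.analytic.continuousAt.tendsto
    rwa [p.map_zero] at this
  refine hZ (eventually_nhdsWithin_iff.1 ?_)
  rw [← p.image_eq]
  refine Filter.eventually_map.2 ?_
  filter_upwards [eventually_all.2 h1, ht.eventually hmem] with t h3 h4
  exact h4.2 h3

theorem PlaneCurve.exists_v_eq (C : PlaneCurve r) (φ : ∀ i, Parametrization (C.comp i))
    (i : Fin r) :
    ∃ N : ℕ, ∀ m : ℕ, N ≤ m → ∃ g : C.Ring, C.v φ i g = m ∧ ∀ l ≠ i, C.v φ l g = ⊤ := by
  have hex : ∀ l, ∃ g, l ≠ i → pullback (φ l).φ (φ l).analytic (φ l).map_zero g = 0 ∧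
      pullback (φ i).φ (φ i).analytic (φ i).map_zero g ≠ 0 := by
    intro l
    by_cases hl : l = i
    · exact ⟨0, fun h => absurd hl h⟩
    · obtain ⟨g, hg⟩ := (φ i).exists_pullback_eq_zero_ne_zero (φ l) (C.irreducible l).1
        (C.not_subset i l (Ne.symm hl))
      exact ⟨g, fun _ => hg⟩
  choose g hg using hex
  -- e vanishes on every branch but the i-th, where it has finite order d; multiplying by e shifts
  -- the available orders by d.
  let e := ∏ l ∈ Finset.univ.erase i, g l
  have hei : pullback (φ i).φ (φ i).analytic (φ i).map_zero e ≠ 0 := by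
    rw [← map_ne_zero_iff HolGerm.taylor HolGerm.taylor_injective, map_prod, map_prod,
      Finset.prod_ne_zero_iff]
    intro l hl
    rw [map_ne_zero_iff HolGerm.taylor HolGerm.taylor_injective]
    exact (hg l (Finset.ne_of_mem_erase hl)).2
  obtain ⟨d, hd⟩ := ENat.ne_top_iff_exists.1 (mt (HolGerm.order_eq_top_iff _).1 hei)
  obtain ⟨N, hN⟩ := (φ i).exists_order_pullback_eq
  refine ⟨d + N, fun m hm => ?_⟩
  obtain ⟨G, hG⟩ := hN (m - d) (by omega)
  refine ⟨Ideal.Quotient.mk _ (e * G), ?_, fun l hl => ?_⟩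
  · change HolGerm.order (pullback (φ i).φ (φ i).analytic (φ i).map_zero (e * G)) = m
    rw [map_mul, HolGerm.order_mul, ← hd, hG]
    norm_cast
    omega
  · change HolGerm.order (pullback (φ l).φ (φ l).analytic (φ l).map_zero (e * G)) = ⊤
    rw [HolGerm.order_eq_top_iff, map_mul, map_prod,
      Finset.prod_eq_zero (Finset.mem_erase.2 ⟨hl, Finset.mem_univ l⟩) (hg l hl).1, zero_mul]

end PlaneCurveSing

end

theorem mainTheorem4 (r : ℕ) (hr : 1 < r) (C : PlaneCurveSing.PlaneCurve r)
    (φ : ∀ i, PlaneCurveSing.Parametrization (C.comp i)) :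
    ∃ Q' Q : MvPolynomial (Fin r) ℤ,
      PlaneCurveSing.ofPoly Q' = C.P' φ ∧
      Q' = PlaneCurveSing.tProdSubOne r * Q ∧
      C.P φ = (Q : MvPowerSeries (Fin r) ℤ) :=
  C.exists_poly_of_exists_order hr φ (C.exists_v_eq φ)
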